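/- Conventions. Divisors in $\mathbb{C}^m$ are algebraic, given by nonzero polynomials (defining equations, up to nonzero constant factors); the sum of two divisors is given by the product of their equations, and the pull-back $f^{-1}(E)$ of $E=V(h)$ under a polynomial map $f$ by $h\circ f$. For $d\in S=\mathbb{C}[x_1,\dots,x_m]$ let $\mathrm{Der}(-\log V(d))=\{\delta\in\Theta : \delta(d)\in (d)\}$, where $\Theta=\mathrm{Der}_{\mathbb{C}}(S)$ is the $S$-module of polynomial vector fields on $\mathbb{C}^m$. A divisor $V(d)$ is \emph{free} if $d$ is squarefree (so the divisor is reduced) and $\mathrm{Der}(-\log V(d))$ is a free $S$-module. A free divisor $D$ is \emph{linear} if $\mathrm{Der}(-\log D)=S\otimes_{\mathbb{C}}\mathrm{Der}(-\log D)_0$, where $\mathrm{Der}(-\log D)_0$ is the complex vector space of those vector fields in $\mathrm{Der}(-\log D)$ whose coefficients are all linear forms. Statement. Let $D\subset V=\mathbb{C}^n$ be a linear free divisor, and let $f=(f_1,\dots,f_k)\colon V\to W=\mathbb{C}^k$ be a polynomial map whose components define a partition of the components of $D$; that is, no $f_i$ is constant and $f_1\cdots f_k$ is a reduced equation of $D$.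 (Such $f_i$ are automatically relative invariants of the identity component $G_D\subset \mathrm{GL}(V)$ of the group of linear automorphisms preserving $D$.) Let $N=V(y_1\cdots y_k)\subset W$ be the normal crossing divisor, and let $E\subset W$ be a divisor such that $N+E$ is free. Then $D+f^{-1}(E)=f^{-1}(N+E)$, and this is a free divisor in $V$. -/

import Mathlib

open MvPolynomial

noncomputable section

/-- The coordinate ring `ℂ[x₁, …, xₙ]` of the affine space `ℂⁿ`.  An effective algebraic divisor in
`ℂⁿ` is given by a nonzero polynomial, its defining equation, which is unique up to a nonzero
constant.  The sum of divisors is given by the product of their equations, and the pull-back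
`f⁻¹(E)` of `E = V(h)` under a polynomial map `f` by the equation `h ∘ f = bind₁ f h`. -/
abbrev CoordRing (n : ℕ) : Type := MvPolynomial (Fin n) ℂ

/-- The module `Θ` of polynomial vector fields on `ℂⁿ`. -/
abbrev VectorField (n : ℕ) : Type := Derivation ℂ (CoordRing n) (CoordRing n)

/-- The module `Der(-log D)` of logarithmic vector fields along the divisor `D = V(d)`: those
vector fields `δ` with `δ(d) ∈ (d)`. -/
def logDer {n : ℕ} (d : CoordRing n) : Submodule (CoordRing n) (VectorField n) where
  carrier := {δ | d ∣ δ d}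
  add_mem' := fun ha hb => dvd_add ha hb
  zero_mem' := dvd_zero d
  smul_mem' := fun c _ ha => Dvd.dvd.mul_left ha c

/-- `d` is a reduced equation of a free divisor: `d` is squarefree (in particular nonzero), and
`Der(-log D)` is a free module over the coordinate ring. -/
structure IsFreeDivisor {n : ℕ} (d : CoordRing n) : Prop where
  squarefree : Squarefree d
  free : Module.Free (CoordRing n) (logDer d)

/-- The space `Der(-log D)₀` of logarithmic vector fields of degree `0` for the grading of `Θ` in
which `xᵢ` has degree `1` and `∂/∂xᵢ` degree `-1`: all coefficients `δ(xᵢ)` are linear forms. -/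
def logDerZero {n : ℕ} (d : CoordRing n) : Submodule ℂ (logDer d) where
  carrier := {δ | ∀ i : Fin n, (δ : VectorField n) (X i) ∈ homogeneousSubmodule (Fin n) ℂ 1}
  add_mem' := fun ha hb i => Submodule.add_mem _ (ha i) (hb i)
  zero_mem' := fun _ => Submodule.zero_mem _
  smul_mem' := fun c _ ha i => Submodule.smul_mem _ c (ha i)

/-- `d` is a reduced equation of a linear free divisor `D`: `D` is a free divisor and
`Der(-log D) = ℂ[x₁, …, xₙ] ⊗_ℂ Der(-log D)₀`. -/
structure IsLinearFreeDivisor {n : ℕ} (d : CoordRing n) : Prop extends IsFreeDivisor d where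
  isBaseChange : IsBaseChange (CoordRing n) (logDerZero d).subtype

/-- The polynomials `f₁, …, f_k` define a partition of the components of `D = V(d)` (where `d` is
squarefree): they are nonconstant, and their product is an equation of `D`.  So every irreducible
factor of `d` divides exactly one `fᵢ`, exactly once, and every `fᵢ` is a product of such. -/
structure IsComponentPartition {n k : ℕ} (d : CoordRing n) (f : Fin k → CoordRing n) : Prop where
  not_isUnit : ∀ i, ¬ IsUnit (f i)
  associated_prod : Associated (∏ i, f i) d

/-- The equation `y₁ ⋯ y_k` of the normal crossing divisor `N` in `ℂᵏ`. -/
def normalCrossing (k : ℕ) : CoordRing k := ∏ i : Fin k, X i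

end

/-! The `f j` are eigenvectors of the linear fields in `Der(-log D)`, with linearly independent
characters: a relation would give `∑ c_j df_j/f_j = 0`, although the summands have distinct poles.
Hence `Der(-log D)` has a basis of lifts of the `y_i ∂/∂y_i` and of fields killing every `f j`
(`exists_adapted_basis`). A combination of these is logarithmic along `f⁻¹(E)` iff its coefficients
`g` on the lifts satisfy `h ∘ f ∣ ∑ g_i (y_i ∂_i h) ∘ f`; the other coefficients are arbitrary. It
remains to see that the module of such `g` is free.

For `f = id` that module is `Der(-log (N + E))`, free by hypothesis. By Saito's criterion, freeness
amounts to a square matrix with rows in the module and determinant dividing the equation, and this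
survives composition with `f`. The criterion needs `h ∘ f` squarefree and, for each prime `p ∣ h ∘
f`, some `(y_i ∂_i h) ∘ f` not divisible by `p`. Both come from the contraction `P` of `(p)` to
`ℂ[y]`. If `p` divides some `f i`, then `P` is monomial and `y_i ∣ h`, against the squarefreeness of
`y_1 ⋯ y_k h`. Otherwise `P` contains the Jacobian minors of its elements, so it is principal and
misses some `∂_i h`. -/

noncomputable section

/-! ### Squarefree elements of a factorial ring -/

section Squarefree

variable {R : Type*} [CommRing R] [UniqueFactorizationMonoid R]

theorem squarefree_of_forall_prime {x : R} (hx : x ≠ 0)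
    (h : ∀ p, Prime p → ¬ p * p ∣ x) : Squarefree x :=
  (squarefree_iff_irreducible_sq_not_dvd_of_ne_zero hx).2 fun p hp => h p hp.prime

theorem Squarefree.dvd_of_forall_prime_dvd [IsDomain R] {x y : R} (hx : Squarefree x)
    (h : ∀ p, Prime p → p ∣ x → p ∣ y) : x ∣ y := by
  induction x using UniqueFactorizationMonoid.induction_on_prime with
  | h₁ => exact absurd hx not_squarefree_zero
  | h₂ x hu => exact hu.dvd
  | h₃ a p ha hp ih =>
    obtain ⟨c, hc⟩ := ih hx.of_mul_right fun q hq hqa => h q hq (dvd_mul_of_dvd_right hqa _)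
    have hpa : ¬ p ∣ a := fun hpa => hp.not_isUnit (hx p (mul_dvd_mul_left p hpa))
    have := h p hp (dvd_mul_right _ _)
    rw [hc] at this ⊢
    obtain ⟨e, rfl⟩ := (hp.dvd_or_dvd this).resolve_left hpa
    exact ⟨e, by ring⟩

end Squarefree

/-! ### Elimination of a variable -/

section Elimination

-- By Gauss's lemma `q` stays irreducible over the fraction field, where Bézout applies; `r` is the
-- cleared denominator.
open Polynomial in
theorem Polynomial.exists_mul_add_mul_eq_C {R : Type*} [CommRing R] [IsDomain R]
    [UniqueFactorizationMonoid R] {q w : R[X]} (hq : Irreducible q) (hdeg : q.natDegree ≠ 0)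
    (hw : ¬ q ∣ w) : ∃ a b : R[X], ∃ r : R, r ≠ 0 ∧ a * q + b * w = C r := by
  classical
  let : NormalizedGCDMonoid R := Classical.arbitrary _
  let K := FractionRing R
  have hprim : q.IsPrimitive := hq.isPrimitive hdeg
  have hirr : Irreducible (q.map (algebraMap R K)) :=
    (hprim.irreducible_iff_irreducible_map_fraction_map).1 hq
  have hnd : ¬ q.map (algebraMap R K) ∣ w.map (algebraMap R K) := fun h =>
    hw (hprim.dvd_of_fraction_map_dvd_fraction_map h)
  obtain ⟨a, b, hab⟩ := (hirr.coprime_iff_not_dvd.2 hnd)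
  obtain ⟨s, hs, hs'⟩ := IsLocalization.integerNormalization_spec (nonZeroDivisors R) a
  obtain ⟨t, ht, ht'⟩ := IsLocalization.integerNormalization_spec (nonZeroDivisors R) b
  refine ⟨C t * IsLocalization.integerNormalization (nonZeroDivisors R) a,
    C s * IsLocalization.integerNormalization (nonZeroDivisors R) b, s * t,
    mul_ne_zero (nonZeroDivisors.ne_zero hs) (nonZeroDivisors.ne_zero ht), ?_⟩
  apply Polynomial.map_injective (algebraMap R K) (IsFractionRing.injective R K)
  simp only [Polynomial.map_add, Polynomial.map_mul, hs', ht', Polynomial.map_C]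
  simp only [Algebra.smul_def, Polynomial.algebraMap_apply, map_mul]
  linear_combination (C (algebraMap R K s) * C (algebraMap R K t)) * hab

end Elimination

/-! ### Partial derivatives and ideals of polynomials -/

namespace MvPolynomial

variable {σ : Type*}

theorem exists_mul_add_mul_eq_of_pderiv_ne_zero {q w : MvPolynomial σ ℂ} (i : σ)
    (hq : Irreducible q) (hi : pderiv i q ≠ 0) (hw : ¬ q ∣ w) :
    ∃ a b r : MvPolynomial σ ℂ, r ≠ 0 ∧ pderiv i r = 0 ∧ a * q + b * w = r := by
  classical
  let φ : Polynomial (MvPolynomial {j // j ≠ i} ℂ) ≃ₐ[ℂ] MvPolynomial σ ℂ :=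
    (optionEquivLeft ℂ {j // j ≠ i}).symm.trans (renameEquiv ℂ (Equiv.optionSubtypeNe i))
  have hC : ∀ r, pderiv i (φ (Polynomial.C r)) = 0 := fun r => by
    have : φ (Polynomial.C r) = rename Subtype.val r := by
      simp only [φ, AlgEquiv.trans_apply, optionEquivLeft_symm_apply, Polynomial.aevalTower_C,
        renameEquiv_apply, rename_rename]
      rfl
    rw [this]
    refine pderiv_eq_zero_of_notMem_vars fun hmem => ?_
    have := vars_rename _ _ hmem
    simp at this
  obtain ⟨a, b, r, hr, hab⟩ := Polynomial.exists_mul_add_mul_eq_C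
    (q := φ.symm q) (w := φ.symm w) ((MulEquiv.irreducible_iff φ.symm).2 hq)
    (fun h => hi (by
      have := hC ((φ.symm q).coeff 0)
      rwa [← Polynomial.eq_C_of_natDegree_eq_zero h, AlgEquiv.apply_symm_apply] at this))
    (fun h => hw (by simpa using map_dvd φ h))
  refine ⟨φ a, φ b, φ (Polynomial.C r), by simpa using hr, hC r, ?_⟩
  rw [← hab]; simp

theorem totalDegree_pderiv_lt {i : σ} {q : MvPolynomial σ ℂ} (h : pderiv i q ≠ 0) :
    (pderiv i q).totalDegree < q.totalDegree := by
  classical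
  obtain ⟨m, hm, hd⟩ := Finset.exists_mem_eq_sup _ (support_nonempty.2 h)
    (fun s => s.sum fun _ e => e)
  have hc : coeff (m + Finsupp.single i 1) q ≠ 0 := fun h0 => by
    rw [mem_support_iff, coeff_pderiv, h0, zero_mul] at hm
    exact hm rfl
  have := le_totalDegree (mem_support_iff.2 hc)
  rw [Finsupp.sum_add_index' (by simp) (by simp), Finsupp.sum_single_index rfl] at this
  rw [totalDegree, hd]
  omega

theorem eq_C_of_forall_pderiv_eq_zero {q : MvPolynomial σ ℂ} (h : ∀ i, pderiv i q = 0) :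
    q = C (coeff 0 q) := by
  classical
  ext m
  rw [coeff_C]
  split_ifs with hm
  · rw [hm]
  · obtain ⟨i, hi⟩ := Finsupp.support_nonempty_iff.2 (Ne.symm hm)
    rw [Finsupp.mem_support_iff] at hi
    have := coeff_pderiv (i := i) q (m - Finsupp.single i 1)
    rw [h i, coeff_zero, tsub_add_cancel_of_le (Finsupp.single_le_iff.2 (by omega))] at this
    refine (mul_eq_zero.1 this.symm).resolve_right ?_
    exact Nat.cast_add_one_ne_zero _

theorem exists_pderiv_ne_zero {q : MvPolynomial σ ℂ} (h0 : q ≠ 0) (hu : ¬ IsUnit q) :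
    ∃ i, pderiv i q ≠ 0 := by
  by_contra! h
  have hq := eq_C_of_forall_pderiv_eq_zero h
  rw [hq] at hu h0
  exact hu ((isUnit_iff_ne_zero.2 fun hc => h0 (by rw [hc, C_0])).map C)

theorem eq_zero_of_dvd_pderiv {i : σ} {q : MvPolynomial σ ℂ} (h : q ∣ pderiv i q) :
    pderiv i q = 0 := by
  by_contra h0
  exact absurd (totalDegree_le_of_dvd_of_isDomain h h0) (totalDegree_pderiv_lt h0).not_ge

/-- A prime divisor of a squarefree polynomial does not divide all its partial derivatives. -/
theorem exists_not_dvd_pderiv {p h : MvPolynomial σ ℂ} (hp : Prime p) (hh : Squarefree h)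
    (hph : p ∣ h) : ∃ i, ¬ p ∣ pderiv i h := by
  obtain ⟨i, hi⟩ := exists_pderiv_ne_zero hp.ne_zero hp.not_isUnit
  refine ⟨i, fun hd => hi (eq_zero_of_dvd_pderiv ?_)⟩
  obtain ⟨u, rfl⟩ := hph
  rw [pderiv_mul] at hd
  have h1 := (dvd_add_left (dvd_mul_right p _)).1 hd
  exact (hp.dvd_or_dvd h1).resolve_right
    fun hu => hp.not_isUnit (hh p (mul_dvd_mul_left p hu))

/-- A nonzero prime ideal of a polynomial ring that contains the `2 × 2` minors of the Jacobian
matrix of its elements is principal; hence it does not contain all the partial derivatives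
of a squarefree element. -/
theorem exists_pderiv_notMem_of_minors_mem (P : Ideal (MvPolynomial σ ℂ)) [hP : P.IsPrime]
    (hminor : ∀ w ∈ P, ∀ v ∈ P, ∀ i j,
      pderiv i w * pderiv j v - pderiv j w * pderiv i v ∈ P)
    {h : MvPolynomial σ ℂ} (hh : Squarefree h) (hhP : h ∈ P) : ∃ i, pderiv i h ∉ P := by
  classical
  have hunit : ∀ x ∈ P, ¬ IsUnit x := fun x hx hu =>
    hP.ne_top (P.eq_top_of_isUnit_mem hx hu)
  -- an element of least degree among those satisfying a condition
  have hmin : ∀ T : Set (MvPolynomial σ ℂ), T.Nonempty →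
      ∃ q ∈ T, ∀ w ∈ T, q.totalDegree ≤ w.totalDegree := fun T hT => by
    obtain ⟨q, hq, hq'⟩ := WellFounded.has_min (measure totalDegree).wf T hT
    exact ⟨q, hq, fun w hw => not_lt.1 (hq' w hw)⟩
  -- Least degree makes `q` irreducible and keeps its nonzero derivatives out of `P`; it will divide
  -- all of `P`.
  obtain ⟨q, ⟨hqP, hq0⟩, hqmin⟩ := hmin {q | q ∈ P ∧ q ≠ 0} ⟨h, hhP, hh.ne_zero⟩
  have hqirr : Irreducible q := by
    refine ⟨hunit q hqP, fun a b hab => ?_⟩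
    have ha0 : a ≠ 0 := by rintro rfl; simp [hab] at hq0
    have hb0 : b ≠ 0 := by rintro rfl; simp [hab] at hq0
    have hdeg : q.totalDegree = a.totalDegree + b.totalDegree := by
      rw [hab, totalDegree_mul_of_isDomain ha0 hb0]
    have hconst : ∀ c : MvPolynomial σ ℂ, c ≠ 0 → c.totalDegree = 0 → IsUnit c := by
      intro c hc0 hc
      rw [totalDegree_eq_zero_iff_eq_C] at hc
      rw [hc] at hc0 ⊢
      exact (isUnit_iff_ne_zero.2 fun hc => hc0 (by rw [hc, C_0])).map C
    rcases hP.mem_or_mem (hab ▸ hqP) with ha | hb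
    · exact Or.inr (hconst b hb0 (by have := hqmin a ⟨ha, ha0⟩; omega))
    · exact Or.inl (hconst a ha0 (by have := hqmin b ⟨hb, hb0⟩; omega))
  obtain ⟨i, hi⟩ := exists_pderiv_ne_zero hq0 (hunit q hqP)
  have hiP : pderiv i q ∉ P := fun hmem =>
    (totalDegree_pderiv_lt hi).not_ge (hqmin _ ⟨hmem, hi⟩)
  have hdvd : ∀ w ∈ P, q ∣ w := by
    intro w hw
    by_contra hqw
    obtain ⟨a, b, r, hr0, hri, hr⟩ := exists_mul_add_mul_eq_of_pderiv_ne_zero i hqirr hi hqw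
    have hrP : r ∈ P := hr ▸ P.add_mem (P.mul_mem_left _ hqP) (P.mul_mem_left _ hw)
    -- Take `v` of least degree free of `X i`. Its minor with `q` is `∂_i q * ∂_j v`, so the smaller
    -- `∂_j v` lies in `P` too.
    obtain ⟨v, ⟨hvP, hv0, hvi⟩, hvmin⟩ :=
      hmin {v | v ∈ P ∧ v ≠ 0 ∧ pderiv i v = 0} ⟨r, hrP, hr0, hri⟩
    obtain ⟨j, hj⟩ := exists_pderiv_ne_zero hv0 (hunit v hvP)
    have hm := hminor q hqP v hvP i j
    rw [hvi, mul_zero, sub_zero] at hm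
    have hcomm : pderiv i (pderiv j v) = 0 := by
      ext m
      have := congrArg (coeff (m + Finsupp.single j 1)) hvi
      simp only [coeff_pderiv, coeff_zero, Finsupp.add_apply] at this ⊢
      rw [add_right_comm] at this
      rcases mul_eq_zero.1 this with h0 | h0
      · rw [h0]; ring
      · exact absurd h0 (by exact Nat.cast_add_one_ne_zero _)
    exact (totalDegree_pderiv_lt hj).not_ge
      (hvmin _ ⟨(hP.mem_or_mem hm).resolve_left hiP, hj, hcomm⟩)
  obtain ⟨j, hj⟩ := exists_not_dvd_pderiv hqirr.prime hh (hdvd h hhP)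
  exact ⟨j, fun hmem => hj (hdvd _ hmem)⟩

/-- An ideal stable under the vector fields `X j ∂/∂X j` is a monomial ideal. -/
theorem monomial_mem_of_X_mul_pderiv_mem (P : Ideal (MvPolynomial σ ℂ))
    (hP : ∀ g ∈ P, ∀ j, X j * pderiv j g ∈ P) (g : MvPolynomial σ ℂ) (hg : g ∈ P)
    (α : σ →₀ ℕ) (hα : α ∈ g.support) : monomial α 1 ∈ P := by
  classical
  have hcoeff : ∀ (g : MvPolynomial σ ℂ) (j : σ) (m : σ →₀ ℕ),
      coeff m (X j * pderiv j g) = m j * coeff m g := fun g j m => by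
    induction g using MvPolynomial.induction_on' with
    | add p q hp hq => rw [map_add, mul_add, coeff_add, hp, hq, coeff_add, mul_add]
    | monomial s a =>
      rw [X_mul_pderiv_monomial, coeff_smul, coeff_monomial]
      split_ifs with h
      · rw [h]; simp
      · simp
  induction hn : g.support.card using Nat.strong_induction_on generalizing g with
  | _ n ih =>
    by_cases hs : ∃ β ∈ g.support, β ≠ α
    · obtain ⟨β, hβ, hne⟩ := hs
      obtain ⟨j, hj⟩ : ∃ j, α j ≠ β j := by
        by_contra! hc
        exact hne (Finsupp.ext fun j => (hc j).symm)
      -- Monomials are eigenvectors of `X j ∂/∂X j`: the term at `β` dies, the one at `α` survives.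
      let g' := X j * pderiv j g - C (β j : ℂ) * g
      have hg'c : ∀ m, coeff m g' = ((m j : ℂ) - β j) * coeff m g := fun m => by
        rw [coeff_sub, hcoeff, coeff_C_mul]; ring
      have hsub : g'.support ⊂ g.support := by
        refine Finset.ssubset_iff_subset_ne.2 ⟨fun m hm => ?_, fun he => ?_⟩
        · rw [mem_support_iff, hg'c] at hm
          exact mem_support_iff.2 (right_ne_zero_of_mul hm)
        · rw [← he, mem_support_iff, hg'c, sub_self, zero_mul] at hβ
          exact hβ rfl
      refine ih _ (hn ▸ Finset.card_lt_card hsub) g'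
        (P.sub_mem (hP g hg j) (P.mul_mem_left _ hg)) ?_ rfl
      rw [mem_support_iff, hg'c]
      refine mul_ne_zero (sub_ne_zero.2 (by exact_mod_cast hj)) (mem_support_iff.1 hα)
    · push Not at hs
      have hg' : g = monomial α (coeff α g) := by
        ext m
        rw [coeff_monomial]
        split_ifs with h
        · rw [h]
        · by_contra h0
          exact h (hs m (mem_support_iff.2 h0)).symm
      have : monomial α 1 = C (coeff α g)⁻¹ * g := by
        conv_rhs => rw [hg']
        rw [C_mul_monomial, coeff_monomial, if_pos rfl, inv_mul_cancel₀ (mem_support_iff.1 hα)]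
      rw [this]
      exact P.mul_mem_left _ hg

end MvPolynomial

/-! ### Saito's criterion for syzygies modulo `H` -/

section Syzygy

open Matrix

/-- The module of vectors `g` with `H ∣ ∑ᵢ gᵢ cᵢ`. -/
def syzygyModulo {S : Type*} [CommRing S] {ι : Type*} [Fintype ι] (H : S) (c : ι → S) :
    Submodule S (ι → S) where
  carrier := {g | H ∣ g ⬝ᵥ c}
  add_mem' := fun {a b} ha hb => by
    simp only [Set.mem_ofPred_eq, add_dotProduct] at *
    exact dvd_add ha hb
  zero_mem' := by simp
  smul_mem' := fun r g hg => by
    simp only [Set.mem_ofPred_eq, smul_dotProduct] at *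
    exact Dvd.dvd.mul_left hg r

variable {S : Type*} [CommRing S] {ι : Type*} [Fintype ι]

theorem mem_syzygyModulo {H : S} {c g : ι → S} : g ∈ syzygyModulo H c ↔ H ∣ g ⬝ᵥ c := Iff.rfl

variable [DecidableEq ι]

/-- Multiply `B c ≡ 0` modulo `H` by the adjugate of `B`. -/
theorem dvd_det_mul_of_forall_mem_syzygyModulo {H : S} {c : ι → S} {B : Matrix ι ι S}
    (hB : ∀ i, B i ∈ syzygyModulo H c) (i : ι) : H ∣ B.det * c i := by
  have h : (B.adjugate *ᵥ (B *ᵥ c)) i = B.det * c i := by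
    rw [mulVec_mulVec, adjugate_mul, smul_mulVec, one_mulVec, Pi.smul_apply, smul_eq_mul]
  rw [← h]
  exact Finset.dvd_sum fun j _ => Dvd.dvd.mul_left (hB j) _

variable [IsDomain S] [UniqueFactorizationMonoid S]

theorem dvd_det_of_forall_mem_syzygyModulo {H : S} {c : ι → S} (hH : Squarefree H)
    (hc : ∀ p, Prime p → p ∣ H → ∃ i, ¬ p ∣ c i) {B : Matrix ι ι S}
    (hB : ∀ i, B i ∈ syzygyModulo H c) : H ∣ B.det := by
  refine hH.dvd_of_forall_prime_dvd fun p hp hpH => ?_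
  obtain ⟨i, hi⟩ := hc p hp hpH
  exact (hp.dvd_or_dvd (hpH.trans (dvd_det_mul_of_forall_mem_syzygyModulo hB i))).resolve_right hi

/-- A form of Saito's criterion. -/
theorem free_syzygyModulo_of_det_dvd {H : S} {c : ι → S} (hH : Squarefree H)
    (hc : ∀ p, Prime p → p ∣ H → ∃ i, ¬ p ∣ c i) {A : Matrix ι ι S}
    (hA : ∀ i, A i ∈ syzygyModulo H c) (hdet : A.det ∣ H) :
    Module.Free S (syzygyModulo H c) := by
  have hA0 : A.det ≠ 0 := fun h0 => hH.ne_zero (zero_dvd_iff.1 (h0 ▸ hdet))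
  have hinj : Function.Injective A.vecMulLinear := by
    rw [injective_iff_map_eq_zero]
    intro v hv
    exact eq_zero_of_vecMul_eq_zero hA0 (by simpa using hv)
  have hrange : LinearMap.range A.vecMulLinear = syzygyModulo H c := by
    apply le_antisymm
    · rintro _ ⟨v, rfl⟩
      rw [vecMulLinear_apply, vecMul_eq_sum]
      exact Submodule.sum_mem _ fun i _ => Submodule.smul_mem _ _ (hA i)
    · intro g hg
      -- Cramer's rule: with a row of `A` replaced by `g`, the determinant is still divisible by
      -- `H`, hence by `A.det`; the quotients are the coordinates of `g`.
      have hdvd : ∀ j, A.det ∣ cramer Aᵀ g j := fun j => by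
        rw [cramer_transpose_apply]
        refine hdet.trans (dvd_det_of_forall_mem_syzygyModulo hH hc fun i => ?_)
        rcases eq_or_ne i j with rfl | hij
        · rwa [updateRow_self]
        · rw [updateRow_ne hij]; exact hA i
      choose v hv using hdvd
      refine ⟨v, ?_⟩
      have h1 := mulVec_cramer Aᵀ g
      rw [mulVec_transpose, det_transpose, show cramer Aᵀ g = A.det • v from funext hv,
        smul_vecMul] at h1
      exact smul_right_injective _ hA0 h1
  rw [← hrange]
  exact Module.Free.of_equiv (LinearEquiv.ofInjective _ hinj)

/-- The determinant of a basis divides that of every matrix with rows in the module. Test matrices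
of determinant `H ^ card ι` and `c i ^ (card ι - 1) * H` show that each prime factor of it divides
`H` and occurs only once. -/
theorem exists_det_dvd_of_free_syzygyModulo [IsNoetherianRing S] {H : S} {c : ι → S}
    (hH : Squarefree H) (hc : ∀ p, Prime p → p ∣ H → ∃ i, ¬ p ∣ c i)
    (hfree : Module.Free S (syzygyModulo H c)) :
    ∃ A : Matrix ι ι S, (∀ i, A i ∈ syzygyModulo H c) ∧ A.det ∣ H := by
  have hHmem : ∀ i, Pi.single i H ∈ syzygyModulo H c := fun i => by
    rw [mem_syzygyModulo, single_dotProduct]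
    exact dvd_mul_right _ _
  have hrank : Module.finrank S (syzygyModulo H c) = Fintype.card ι := by
    apply le_antisymm
    · simpa using Submodule.finrank_le (syzygyModulo H c)
    · have hli : LinearIndependent S
          (fun i => (⟨Pi.single i H, hHmem i⟩ : syzygyModulo H c)) := by
        apply LinearIndependent.of_comp (syzygyModulo H c).subtype
        rw [Fintype.linearIndependent_iff]
        intro g hg i
        have := congrFun hg i
        simp [Finset.sum_apply, Pi.single_apply] at this
        exact this.resolve_right hH.ne_zero
      exact hli.fintype_card_le_finrank
  let b := (Module.finBasisOfFinrankEq S (syzygyModulo H c) hrank).reindex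
    (Fintype.equivFin ι).symm
  refine ⟨Matrix.of fun i => (b i : ι → S), fun i => (b i).2, ?_⟩
  set A : Matrix ι ι S := Matrix.of fun i => (b i : ι → S) with hAdef
  have hdvd : ∀ B : Matrix ι ι S, (∀ i, B i ∈ syzygyModulo H c) → A.det ∣ B.det := by
    intro B hB
    have : B = (Matrix.of fun i j => b.repr ⟨B i, hB i⟩ j) * A := by
      ext i j
      have h1 := congrArg (fun x : syzygyModulo H c => (x : ι → S) j)
        (b.sum_repr ⟨B i, hB i⟩)
      simp only [Submodule.coe_sum, Submodule.coe_smul, Finset.sum_apply, Pi.smul_apply,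
        smul_eq_mul] at h1
      rw [← h1]; rfl
    rw [this, det_mul]
    exact dvd_mul_left _ _
  have hpow : A.det ∣ H ^ Fintype.card ι := by
    have := hdvd (Matrix.diagonal fun _ => H) fun i => by
      have : (Matrix.diagonal fun _ : ι => H) i = Pi.single i H := by
        ext j; simp [Matrix.diagonal_apply, Pi.single_apply, eq_comm]
      rw [this]; exact hHmem i
    simpa using this
  have hcH : ∀ i, A.det ∣ c i ^ (Fintype.card ι - 1) * H := fun i => by
    -- The rows are `H e_i` and, for `j ≠ i`, the trivial syzygies `c_i e_j - c_j e_i`.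
    let v : ι → S := fun j => if j = i then H else - c j
    have h1 := hdvd (updateCol (c i • (1 : Matrix ι ι S)) i v) fun j => by
      rw [mem_syzygyModulo]
      rcases eq_or_ne j i with rfl | hij
      · have : updateCol (c j • (1 : Matrix ι ι S)) j v j = Pi.single j H := by
          ext l
          rcases eq_or_ne l j with rfl | hl
          · simp [v]
          · simp [hl.symm, hl]
        rw [this]; exact hHmem j
      · have : updateCol (c i • (1 : Matrix ι ι S)) i v j
            = Pi.single j (c i) + Pi.single i (- c j) := by
          ext l
          rcases eq_or_ne l i with rfl | hl
          · simp [v, hij, hij.symm]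
          · rw [updateCol_ne hl]
            simp [hl, Matrix.one_apply, Pi.single_apply, eq_comm]
        rw [this, add_dotProduct, single_dotProduct, single_dotProduct,
          show c i * c j + -c j * c i = 0 by ring]
        exact dvd_zero _
    rw [← cramer_apply, cramer_eq_adjugate_mulVec, adjugate_smul, adjugate_one] at h1
    simpa [smul_mulVec, v] using h1
  have hpp : ∀ p, Prime p → p ∣ A.det → p ∣ H := fun p hp h =>
    hp.dvd_of_dvd_pow (h.trans hpow)
  have hsq : Squarefree A.det := by
    refine squarefree_of_forall_prime
      (fun h0 => pow_ne_zero _ hH.ne_zero (zero_dvd_iff.1 (h0 ▸ hpow))) fun p hp hpA => ?_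
    obtain ⟨i, hi⟩ := hc p hp (hpp p hp ((dvd_mul_right p p).trans hpA))
    have h2 : p ^ 2 ∣ c i ^ (Fintype.card ι - 1) * H := by
      rw [sq]; exact hpA.trans (hcH i)
    have h3 := hp.pow_dvd_of_dvd_mul_left 2 (fun h => hi (hp.dvd_of_dvd_pow h)) h2
    exact hp.not_isUnit (hH p (by rwa [← sq]))
  exact hsq.dvd_of_forall_prime_dvd hpp

end Syzygy

/-! ### Pull-back of divisors along `f` -/

section Relative

variable {n k : ℕ}

theorem derivation_bind₁ (D : VectorField n) (f : Fin k → CoordRing n) (h : CoordRing k) :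
    D (bind₁ f h) = ∑ j, bind₁ f (pderiv j h) * D (f j) := by
  classical
  induction h using MvPolynomial.induction_on with
  | C a => simp
  | add p q hp hq => simp only [map_add, hp, hq, add_mul, Finset.sum_add_distrib]
  | mul_X p i hp =>
    simp only [map_mul, bind₁_X_right, Derivation.leibniz, hp, smul_eq_mul, map_add, pderiv_X,
      add_mul, Finset.sum_add_distrib, Pi.single_apply]
    congr 1
    · simp [apply_ite]
    · rw [Finset.mul_sum]
      exact Finset.sum_congr rfl fun j _ => by ring

theorem derivation_bind₁_of_eq_mul {D : VectorField n} {f g : Fin k → CoordRing n}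
    (hg : ∀ j, D (f j) = g j * f j) (h : CoordRing k) :
    D (bind₁ f h) = g ⬝ᵥ fun j => bind₁ f (X j * pderiv j h) := by
  rw [derivation_bind₁, dotProduct]
  refine Finset.sum_congr rfl fun j _ => ?_
  rw [hg, map_mul, bind₁_X_right]
  ring

/-- The vector fields `δ i` are lifts of the vector fields `X i ∂/∂X i` along `f`. -/
def IsDiagonalLift (f : Fin k → CoordRing n) (δ : Fin k → VectorField n) : Prop :=
  ∀ i j, δ i (f j) = (Pi.single i 1 : Fin k → CoordRing n) j * f j

variable {f : Fin k → CoordRing n} {δ : Fin k → VectorField n}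

theorem IsDiagonalLift.apply_bind₁ (hδ : IsDiagonalLift f δ) (i : Fin k) (h : CoordRing k) :
    δ i (bind₁ f h) = bind₁ f (X i * pderiv i h) := by
  rw [derivation_bind₁_of_eq_mul (hδ i) h, single_dotProduct, one_mul]

/-- The kernel of `bind₁ f` is a monomial ideal, and no monomial in nonzero `f i` vanishes. -/
theorem IsDiagonalLift.bind₁_ne_zero (hδ : IsDiagonalLift f δ) (hf : ∀ i, f i ≠ 0)
    {h : CoordRing k} (hh : h ≠ 0) : bind₁ f h ≠ 0 := by
  intro h0
  obtain ⟨α, hα⟩ := support_nonempty.2 hh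
  have := monomial_mem_of_X_mul_pderiv_mem (RingHom.ker (bind₁ f)) (fun g hg j => by
    rw [RingHom.mem_ker] at hg ⊢
    rw [← hδ.apply_bind₁, hg, map_zero]) h h0 α hα
  rw [RingHom.mem_ker, bind₁_monomial, C_1, one_mul] at this
  obtain ⟨i, -, hi⟩ := Finset.prod_eq_zero_iff.1 this
  exact hf i (eq_zero_of_pow_eq_zero hi)

theorem mem_comap_bind₁ {p : CoordRing n} {g : CoordRing k} :
    g ∈ (Ideal.span {p}).comap (bind₁ f) ↔ p ∣ bind₁ f g := by
  rw [Ideal.mem_comap, Ideal.mem_span_singleton]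

theorem isPrime_comap_bind₁ {p : CoordRing n} (hp : Prime p) :
    ((Ideal.span {p}).comap (bind₁ f)).IsPrime :=
  have := (Ideal.span_singleton_prime hp.ne_zero).2 hp
  Ideal.IsPrime.comap _

theorem not_dvd_of_squarefree_prod (hsq : Squarefree (∏ i, f i)) {p : CoordRing n} (hp : Prime p)
    {i j : Fin k} (hi : p ∣ f i) (hij : j ≠ i) : ¬ p ∣ f j := by
  classical
  intro hj
  refine hp.not_isUnit (hsq p ?_)
  rw [← Finset.mul_prod_erase _ _ (Finset.mem_univ i),
    ← Finset.mul_prod_erase _ _ (Finset.mem_erase.2 ⟨hij, Finset.mem_univ j⟩), ← mul_assoc]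
  exact dvd_mul_of_dvd_left (mul_dvd_mul hi hj) _

theorem dvd_derivation_of_mul_dvd {D : VectorField n} {p g : CoordRing n} (h : p * p ∣ g) :
    p ∣ D g := by
  obtain ⟨u, rfl⟩ := h
  simp only [Derivation.leibniz, smul_eq_mul]
  exact ⟨p * D u + u * D p + u * D p, by ring⟩

/-- Every prime factor of `f i` maps dominantly to the coordinate hyperplane `X i = 0`. -/
theorem IsDiagonalLift.X_dvd (hδ : IsDiagonalLift f δ) (hsq : Squarefree (∏ i, f i))
    {p : CoordRing n} (hp : Prime p) {i : Fin k} (hi : p ∣ f i) {h : CoordRing k}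
    (hph : p ∣ bind₁ f h) : X i ∣ h := by
  classical
  have hP := isPrime_comap_bind₁ (f := f) hp
  have hfi : Squarefree (f i) := hsq.squarefree_of_dvd (Finset.dvd_prod_of_mem f (Finset.mem_univ i))
  -- `p` is a simple factor of `f i`, and `δ j (f i)` is a multiple of `f i`.
  have hδp : ∀ j, p ∣ δ j p := fun j => by
    have h1 : p ∣ δ j (f i) := by rw [hδ]; exact Dvd.dvd.mul_left hi _
    obtain ⟨u, hu⟩ := hi
    rw [hu, Derivation.leibniz, smul_eq_mul, smul_eq_mul] at h1
    refine (hp.dvd_or_dvd ((dvd_add_right (dvd_mul_right p _)).1 h1)).resolve_left fun h2 =>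
      hp.not_isUnit (hfi p ?_)
    rw [hu]; exact mul_dvd_mul_left p h2
  have hmon := monomial_mem_of_X_mul_pderiv_mem _ (fun g hg j => by
    rw [mem_comap_bind₁] at hg ⊢
    rw [← hδ.apply_bind₁]
    obtain ⟨u, hu⟩ := hg
    rw [hu, Derivation.leibniz, smul_eq_mul, smul_eq_mul]
    exact dvd_add (dvd_mul_right _ _) (Dvd.dvd.mul_left (hδp j) _)) h (mem_comap_bind₁.2 hph)
  rw [X_dvd_iff_modMonomial_eq_zero]
  ext α
  rw [coeff_zero]
  by_cases hα : Finsupp.single i 1 ≤ α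
  · exact coeff_modMonomial_of_le _ hα
  · rw [coeff_modMonomial_of_not_le _ hα]
    by_contra h0
    have h1 := mem_comap_bind₁.1 (hmon α (mem_support_iff.2 h0))
    rw [bind₁_monomial, C_1, one_mul, hp.dvd_finsetProd_iff] at h1
    obtain ⟨j, hj, hpj⟩ := h1
    rcases eq_or_ne j i with rfl | hji
    · rw [Finsupp.mem_support_iff] at hj
      exact hα (Finsupp.single_le_iff.2 (Nat.pos_of_ne_zero hj))
    · exact not_dvd_of_squarefree_prod hsq hp hi hji (hp.dvd_of_dvd_pow hpj)

/-- Away from the divisor `V(∏ f)` the map `f` is a submersion, hence the pull-back of a reduced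
divisor is reduced there. -/
theorem IsDiagonalLift.exists_not_dvd_of_not_dvd (hδ : IsDiagonalLift f δ) {p : CoordRing n}
    (hp : Prime p) (hpf : ∀ i, ¬ p ∣ f i) {h : CoordRing k} (hh : Squarefree h)
    (hph : p ∣ bind₁ f h) : ∃ i, ¬ p ∣ bind₁ f (X i * pderiv i h) := by
  have hP := isPrime_comap_bind₁ (f := f) hp
  have hcancel : ∀ i g, p ∣ f i * g → p ∣ g := fun i g hg =>
    (hp.dvd_or_dvd hg).resolve_left (hpf i)
  have hder : ∀ (i : Fin k) (w : CoordRing k), f i * bind₁ f (pderiv i w) = δ i (bind₁ f w) :=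
    fun i w => by rw [hδ.apply_bind₁, map_mul, bind₁_X_right]
  obtain ⟨i, hi⟩ := exists_pderiv_notMem_of_minors_mem _ (fun w hw v hv i j => by
    rw [mem_comap_bind₁] at hw hv ⊢
    obtain ⟨a, ha⟩ := hw
    obtain ⟨b, hb⟩ := hv
    apply hcancel i
    apply hcancel j
    -- Modulo `p` the right side is `a * δ l p`: the gradients of all elements of the contraction,
    -- rescaled by the `f l`, are proportional to one vector, so the minors vanish.
    have e : ∀ (l : Fin k) (w : CoordRing k) (a : CoordRing n), bind₁ f w = p * a →
        f l * bind₁ f (pderiv l w) = p * δ l a + a * δ l p := fun l w a h => by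
      rw [hder, h, Derivation.leibniz, smul_eq_mul, smul_eq_mul]
    rw [map_sub, map_mul, map_mul]
    refine ⟨δ i a * (p * δ j b + b * δ j p) + a * δ i p * δ j b
      - δ j a * (p * δ i b + b * δ i p) - a * δ j p * δ i b, ?_⟩
    linear_combination (f j * bind₁ f (pderiv j v)) * e i w a ha
      + (p * δ i a + a * δ i p) * e j v b hb - (f i * bind₁ f (pderiv i v)) * e j w a ha
      - (p * δ j a + a * δ j p) * e i v b hb) hh (mem_comap_bind₁.2 hph)
  refine ⟨i, fun hd => hi (mem_comap_bind₁.2 (hcancel i _ ?_))⟩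
  rwa [map_mul, bind₁_X_right] at hd

theorem not_X_dvd_of_squarefree {h : CoordRing k} (hh : Squarefree (normalCrossing k * h))
    (i : Fin k) : ¬ X i ∣ h := fun hi =>
  (X_prime (i := i)).not_isUnit (hh (X i) (mul_dvd_mul (Finset.dvd_prod_of_mem _ (Finset.mem_univ i)) hi))

theorem IsDiagonalLift.not_dvd (hδ : IsDiagonalLift f δ) (hsq : Squarefree (∏ i, f i))
    {h : CoordRing k} (hh : Squarefree (normalCrossing k * h))
    {p : CoordRing n} (hp : Prime p) (hph : p ∣ bind₁ f h)
    (i : Fin k) : ¬ p ∣ f i := fun hi =>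
  not_X_dvd_of_squarefree hh i (hδ.X_dvd hsq hp hi hph)

theorem IsDiagonalLift.exists_not_dvd (hδ : IsDiagonalLift f δ) (hsq : Squarefree (∏ i, f i))
    {h : CoordRing k} (hh : Squarefree (normalCrossing k * h))
    {p : CoordRing n} (hp : Prime p) (hph : p ∣ bind₁ f h) :
    ∃ i, ¬ p ∣ bind₁ f (X i * pderiv i h) :=
  hδ.exists_not_dvd_of_not_dvd hp (hδ.not_dvd hsq hh hp hph) hh.of_mul_right hph

/-- The two factors share no prime. If `p ^ 2` divides `bind₁ f h`, then `p` divides every `δ i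
(bind₁ f h)`, which `exists_not_dvd` excludes. -/
theorem IsDiagonalLift.squarefree_mul_bind₁ (hδ : IsDiagonalLift f δ) (hsq : Squarefree (∏ i, f i))
    {h : CoordRing k} (hh : Squarefree (normalCrossing k * h)) :
    Squarefree ((∏ i, f i) * bind₁ f h) := by
  refine squarefree_of_forall_prime (mul_ne_zero hsq.ne_zero (hδ.bind₁_ne_zero
    (fun i => Finset.prod_ne_zero_iff.1 hsq.ne_zero i (Finset.mem_univ i))
    hh.of_mul_right.ne_zero)) fun p hp hpp => ?_
  rw [← sq] at hpp
  by_cases hph : p ∣ bind₁ f h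
  · have hpd : ¬ p ∣ ∏ i, f i := fun hd => by
      obtain ⟨i, -, hi⟩ := (hp.dvd_finsetProd_iff _).1 hd
      exact hδ.not_dvd hsq hh hp hph i hi
    obtain ⟨i, hi⟩ := hδ.exists_not_dvd hsq hh hp hph
    rw [← hδ.apply_bind₁] at hi
    exact hi (dvd_derivation_of_mul_dvd (sq p ▸ hp.pow_dvd_of_dvd_mul_left 2 hpd hpp))
  · exact hp.not_isUnit (hsq p (sq p ▸ hp.pow_dvd_of_dvd_mul_right 2 hph hpp))

end Relative

/-! ### Logarithmic fields and the normal crossing divisor -/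

section LogDer

variable {n k : ℕ}

theorem mem_logDer {d : CoordRing n} {D : VectorField n} : D ∈ logDer d ↔ d ∣ D d := Iff.rfl

theorem logDer_eq_of_associated {d e : CoordRing n} (h : Associated d e) :
    logDer d = logDer e := by
  have key : ∀ {d e : CoordRing n}, Associated d e → logDer d ≤ logDer e := by
    rintro d _ ⟨u, rfl⟩ D hD
    rw [mem_logDer, Derivation.leibniz, smul_eq_mul, smul_eq_mul]
    have hu : (d * u : CoordRing n) ∣ d := (Associated.symm ⟨u, rfl⟩).dvd
    exact dvd_add (hu.trans (dvd_mul_right _ _))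
      (hu.trans (Dvd.dvd.mul_left hD _))
  exact le_antisymm (key h) (key h.symm)

theorem logDer_mul {a b : CoordRing n} (hab : Squarefree (a * b)) :
    logDer (a * b) = logDer a ⊓ logDer b := by
  have hrel : IsRelPrime a b := (squarefree_mul_iff.1 hab).1
  ext D
  rw [Submodule.mem_inf, mem_logDer, mem_logDer, mem_logDer, Derivation.leibniz, smul_eq_mul,
    smul_eq_mul]
  constructor
  · intro h
    constructor
    · have h1 := (dvd_add_right (dvd_mul_right a (D b))).1 ((dvd_mul_right a b).trans h)
      exact hrel.dvd_of_dvd_mul_left h1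
    · have h1 := (dvd_add_left (dvd_mul_right b (D a))).1 ((dvd_mul_left b a).trans h)
      exact hrel.symm.dvd_of_dvd_mul_left h1
  · rintro ⟨ha, hb⟩
    exact dvd_add (mul_dvd_mul_left a hb) (mul_comm a b ▸ mul_dvd_mul_left b ha)

theorem mem_logDer_prod {f : Fin k → CoordRing n} (hsq : Squarefree (∏ i, f i))
    {D : VectorField n} : D ∈ logDer (∏ i, f i) ↔ ∀ i, f i ∣ D (f i) := by
  classical
  have key : ∀ s : Finset (Fin k), Squarefree (∏ i ∈ s, f i) →
      (D ∈ logDer (∏ i ∈ s, f i) ↔ ∀ i ∈ s, f i ∣ D (f i)) := by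
    intro s
    induction s using Finset.induction_on with
    | empty => simp [mem_logDer]
    | insert a s ha ih =>
      intro hs
      rw [Finset.prod_insert ha] at hs ⊢
      rw [logDer_mul hs, Submodule.mem_inf, ih hs.of_mul_right, Finset.forall_mem_insert,
        mem_logDer]
  simpa using key Finset.univ hsq

/-- The identity map as a case of `f`, so that the pull-back lemmas also apply to `h` itself. -/
theorem isDiagonalLift_X :
    IsDiagonalLift (X : Fin k → CoordRing k) fun i => (X i : CoordRing k) • pderiv i := by
  classical
  intro i j
  rcases eq_or_ne i j with rfl | hij
  · simp
  · simp [pderiv_X_of_ne hij.symm, hij.symm]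

/-- The `X i ∂/∂X i` form a basis of `Der(-log N)`; the syzygy condition says that a combination is
also logarithmic along `V(h)`. -/
theorem free_syzygyModulo_of_isFreeDivisor {h : CoordRing k}
    (hh : IsFreeDivisor (normalCrossing k * h)) :
    Module.Free (CoordRing k) (syzygyModulo h fun i => X i * pderiv i h) := by
  classical
  let φ : (Fin k → CoordRing k) →ₗ[CoordRing k] VectorField k :=
    Fintype.linearCombination (CoordRing k) fun i => (X i : CoordRing k) • pderiv i
  have hφX : ∀ a j, φ a (X j) = a j * X j := fun a j => by
    simp only [φ, Fintype.linearCombination_apply]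
    rw [← Derivation.coeFnAddMonoidHom_apply, map_sum, Finset.sum_apply]
    rw [Finset.sum_eq_single j]
    · simp
    · intro b _ hb
      simp [pderiv_X_of_ne hb.symm]
    · simp
  have hφ : ∀ a, φ a h = a ⬝ᵥ fun i => X i * pderiv i h := fun a => by
    have := derivation_bind₁_of_eq_mul (hφX a) h
    simpa [bind₁_X_left] using this
  have hinj : Function.Injective φ := fun a b hab => funext fun j =>
    mul_right_cancel₀ (X_ne_zero j) (by rw [← hφX, ← hφX, hab])
  have hN : Squarefree (∏ i : Fin k, (X i : CoordRing k)) := hh.squarefree.of_mul_left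
  have hmap : (syzygyModulo h fun i => X i * pderiv i h).map φ
      = logDer (normalCrossing k * h) := by
    rw [logDer_mul hh.squarefree]
    ext D
    rw [Submodule.mem_inf, normalCrossing, mem_logDer_prod hN]
    constructor
    · rintro ⟨a, ha, rfl⟩
      refine ⟨fun i => hφX a i ▸ dvd_mul_left _ _, ?_⟩
      rw [mem_logDer, hφ]
      exact ha
    · rintro ⟨h1, h2⟩
      choose a ha using h1
      have hD : φ a = D := derivation_ext fun i => by rw [hφX, ha, mul_comm]
      refine ⟨a, ?_, hD⟩
      rw [← hD, mem_logDer, hφ] at h2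
      exact h2
  have := hh.free
  rw [← hmap] at this
  exact Module.Free.of_equiv (Submodule.equivMapOfInjective φ hinj _).symm

/-- A Saito matrix for `h` maps to one for `bind₁ f h`, because a ring homomorphism respects
determinants and divisibility. -/
theorem free_syzygyModulo_bind₁ {f : Fin k → CoordRing n} {δ : Fin k → VectorField n}
    (hδ : IsDiagonalLift f δ) (hsq : Squarefree (∏ i, f i)) {h : CoordRing k}
    (hh : IsFreeDivisor (normalCrossing k * h)) :
    Module.Free (CoordRing n)
      (syzygyModulo (bind₁ f h) fun i => bind₁ f (X i * pderiv i h)) := by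
  classical
  have hsqh := hh.squarefree
  obtain ⟨A, hA, hdet⟩ := exists_det_dvd_of_free_syzygyModulo hsqh.of_mul_right (fun p hp hph => by
    have := isDiagonalLift_X.exists_not_dvd hsqh.of_mul_left hsqh hp
      (by simpa [bind₁_X_left] using hph)
    simpa only [bind₁_X_left, AlgHom.id_apply] using this) (free_syzygyModulo_of_isFreeDivisor hh)
  refine free_syzygyModulo_of_det_dvd (A := A.map (bind₁ f))
    (hδ.squarefree_mul_bind₁ hsq hsqh).of_mul_right
    (fun p hp hph => hδ.exists_not_dvd hsq hsqh hp hph) (fun i => ?_) ?_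
  · have := map_dvd (bind₁ f) (hA i)
    rw [mem_syzygyModulo]
    simpa only [dotProduct, map_sum, map_mul, Matrix.map_apply] using this
  · have := map_dvd (bind₁ f) hdet
    rwa [AlgHom.map_det] at this

end LogDer

/-! ### Splittings and free submodules -/

section Module

theorem exists_basis_sum_of_surjective {K V ι : Type*} [Field K] [AddCommMonoid V] [Module K V]
    [Fintype ι] [DecidableEq ι] (χ : V →ₗ[K] ι → K) (hχ : Function.Surjective χ) :
    ∃ (κ : Set (LinearMap.ker χ)) (b : Module.Basis (ι ⊕ κ) K V),
      (∀ i, χ (b (Sum.inl i)) = Pi.single i 1) ∧ ∀ s, χ (b (Sum.inr s)) = 0 := by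
  let : AddCommGroup V := Module.addCommMonoidToAddCommGroup K
  obtain ⟨s, hs⟩ := χ.exists_rightInverse_of_surjective (LinearMap.range_eq_top.2 hχ)
  have hs' : ∀ a, χ (s a) = a := LinearMap.congr_fun hs
  let e : ((ι → K) × LinearMap.ker χ) ≃ₗ[K] V :=
    LinearEquiv.ofBijective (s.coprod (LinearMap.ker χ).subtype) <| by
      constructor
      · rw [injective_iff_map_eq_zero]
        rintro ⟨a, x⟩ h
        simp only [LinearMap.coprod_apply, Submodule.subtype_apply] at h
        have ha := congrArg χ h
        rw [map_add, hs', LinearMap.mem_ker.1 x.2, add_zero, map_zero] at ha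
        rw [ha, map_zero, zero_add] at h
        exact Prod.ext ha (Subtype.ext h)
      · intro v
        exact ⟨(χ v, ⟨v - s (χ v), by rw [LinearMap.mem_ker, map_sub, hs', sub_self]⟩), by simp⟩
  refine ⟨_, ((Pi.basisFun K ι).prod
    (Module.Basis.ofVectorSpace K (LinearMap.ker χ))).map e, fun i => ?_, fun t => ?_⟩
  · have : χ (e (Pi.single i 1, 0)) = Pi.single i 1 := by
      change χ (s (Pi.single i 1) + (0 : V)) = _
      rw [add_zero, hs']
    simpa using this
  · have : ∀ x, χ (e (0, x)) = 0 := fun x => by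
      change χ (s 0 + (x : V)) = 0
      rw [map_zero, zero_add, LinearMap.mem_ker.1 x.2]
    simp [this]

theorem free_comap_fst {S L V W : Type*} [Semiring S] [AddCommMonoid L] [Module S L]
    [AddCommMonoid V] [Module S V] [AddCommMonoid W] [Module S W] [Module.Free S W]
    (e : L ≃ₗ[S] V × W) (M : Submodule S V) [Module.Free S M] :
    Module.Free S (M.comap (LinearMap.fst S V W ∘ₗ e.toLinearMap)) :=
  Module.Free.of_equiv (LinearEquiv.symm (σ := RingHom.id S)
    { toFun := fun y => ((⟨(e y).1, y.2⟩, (e y).2) : M × W)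
      invFun := fun x => ⟨e.symm (x.1, x.2), by simp⟩
      map_add' := fun x y => by ext <;> simp
      map_smul' := fun c x => by ext <;> simp
      left_inv := fun x => by simp
      right_inv := fun y => by simp })

end Module

/-! ### Characters of the linear logarithmic fields -/

section LinearFree

variable {n k : ℕ}

theorem totalDegree_derivation_le {D : VectorField n}
    (hD : ∀ i, D (X i) ∈ homogeneousSubmodule (Fin n) ℂ 1) (q : CoordRing n) :
    (D q).totalDegree ≤ q.totalDegree := by
  have h := derivation_bind₁ D X q
  simp only [bind₁_X_left, AlgHom.id_apply] at h
  rw [h]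
  refine totalDegree_finsetSum_le fun j _ => ?_
  rcases eq_or_ne (pderiv j q) 0 with h0 | h0
  · simp [h0]
  · have h1 := totalDegree_pderiv_lt h0
    have h2 := totalDegree_mul (pderiv j q) (D (X j))
    have h3 := ((mem_homogeneousSubmodule _ _).1 (hD j)).totalDegree_le
    omega

/-- A field with linear coefficients does not raise degrees, so the cofactor is constant. -/
theorem exists_eq_C_mul_of_dvd {D : VectorField n}
    (hD : ∀ i, D (X i) ∈ homogeneousSubmodule (Fin n) ℂ 1) {q : CoordRing n} (hq : q ≠ 0)
    (hdvd : q ∣ D q) : ∃ c : ℂ, D q = C c * q := by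
  obtain ⟨u, hu⟩ := hdvd
  rcases eq_or_ne u 0 with rfl | h0
  · exact ⟨0, by rw [hu]; simp⟩
  · have h1 := totalDegree_derivation_le hD q
    rw [hu, totalDegree_mul_of_isDomain hq h0] at h1
    have h2 := totalDegree_eq_zero_iff_eq_C.1 (show u.totalDegree = 0 by omega)
    exact ⟨_, by rw [hu, mul_comm, ← h2]⟩

variable {d : CoordRing n} {f : Fin k → CoordRing n}

/-- The characters of the relative invariants `f i` on the Lie algebra of linear logarithmic
vector fields. -/
theorem exists_characters (hsq : Squarefree (∏ i, f i)) (hd : Associated (∏ i, f i) d) :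
    ∃ χ : logDerZero d →ₗ[ℂ] Fin k → ℂ,
      ∀ D : logDerZero d, ∀ j, (D : logDer d).1 (f j) = C (χ D j) * f j := by
  have hf0 : ∀ j, f j ≠ 0 := fun j => Finset.prod_ne_zero_iff.1 hsq.ne_zero j (Finset.mem_univ j)
  have hex : ∀ D : logDerZero d, ∀ j, ∃ c : ℂ, (D : logDer d).1 (f j) = C c * f j := fun D j => by
    have hmem : D.1.1 ∈ logDer (∏ i, f i) := (logDer_eq_of_associated hd).ge D.1.2
    exact exists_eq_C_mul_of_dvd D.2 (hf0 j) ((mem_logDer_prod hsq).1 hmem j)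
  choose χ hχ using hex
  refine ⟨⟨⟨χ, fun D E => funext fun j => ?_⟩, fun c D => funext fun j => ?_⟩, hχ⟩
  · apply C_injective (Fin n) ℂ
    apply mul_right_cancel₀ (hf0 j)
    rw [← hχ, Pi.add_apply, C_add, add_mul, ← hχ, ← hχ]
    rfl
  · apply C_injective (Fin n) ℂ
    apply mul_right_cancel₀ (hf0 j)
    rw [← hχ, RingHom.id_apply, Pi.smul_apply, smul_eq_mul, C_mul, mul_assoc, ← hχ, ← smul_eq_C_mul]
    rfl

theorem characters_surjective (hb : IsBaseChange (CoordRing n) (logDerZero d).subtype)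
    (hsq : Squarefree (∏ i, f i)) (hu : ∀ i, ¬ IsUnit (f i)) (hd : Associated (∏ i, f i) d)
    {χ : logDerZero d →ₗ[ℂ] Fin k → ℂ}
    (hχ : ∀ D : logDerZero d, ∀ j, (D : logDer d).1 (f j) = C (χ D j) * f j) :
    Function.Surjective χ := by
  classical
  rw [← LinearMap.range_eq_top]
  by_contra hne
  obtain ⟨l, hl0, hl⟩ := Submodule.exists_le_ker_of_lt_top _ (lt_top_iff_ne_top.2 hne)
  let c : Fin k → ℂ := fun i => l (Pi.single i 1)
  have hlc : ∀ v, l v = ∑ i, v i * c i := fun v => by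
    rw [LinearMap.pi_apply_eq_sum_univ l v]
    refine Finset.sum_congr rfl fun i _ => ?_
    rw [smul_eq_mul, show (fun j => if i = j then (1 : ℂ) else 0) = Pi.single i 1 from
      funext fun j => by simp [Pi.single_apply, eq_comm]]
  -- `Λ D` is `∑ c_i D(f_i)/f_i` with denominators cleared. It vanishes on the linear fields, hence
  -- on `logDer d` by base change, hence on every `∂_s` because `d ∂_s` is logarithmic.
  let Λ : VectorField n →ₗ[CoordRing n] CoordRing n :=
    ∑ i, (C (c i) * ∏ j ∈ Finset.univ.erase i, f j) •
      ({ toFun := fun D => D (f i), map_add' := fun _ _ => rfl, map_smul' := fun _ _ => rfl } :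
        VectorField n →ₗ[CoordRing n] CoordRing n)
  have hΛ : ∀ D, Λ D = ∑ i, (C (c i) * ∏ j ∈ Finset.univ.erase i, f j) * D (f i) := fun D => by
    simp [Λ, LinearMap.sum_apply]
  have hzero : Λ ∘ₗ (logDer d).subtype = 0 := by
    refine hb.algHom_ext _ _ fun D => ?_
    have h1 : ∑ i, χ D i * c i = 0 := by
      rw [← hlc]; exact hl (LinearMap.mem_range_self χ D)
    have h2 : Λ (D : logDer d).1 = C (∑ i, χ D i * c i) * ∏ i, f i := by
      rw [hΛ, map_sum, Finset.sum_mul]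
      refine Finset.sum_congr rfl fun i hi => ?_
      rw [hχ, ← Finset.mul_prod_erase _ _ hi, C_mul]
      ring
    rw [h1, C_0, zero_mul] at h2
    exact h2
  have hd0 : d ≠ 0 := hd.ne_zero_iff.1 hsq.ne_zero
  have hs : ∀ s, ∑ i, (C (c i) * ∏ j ∈ Finset.univ.erase i, f j) * pderiv s (f i) = 0 := by
    intro s
    have h1 := LinearMap.congr_fun hzero ⟨d • pderiv s, by
      rw [mem_logDer, Derivation.smul_apply, smul_eq_mul]; exact dvd_mul_right _ _⟩
    change Λ (d • pderiv s) = 0 at h1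
    rw [map_smul, smul_eq_mul] at h1
    rw [← hΛ]
    exact (mul_eq_zero.1 h1).resolve_left hd0
  have hc : ∃ i, c i ≠ 0 := by
    by_contra! h
    exact hl0 (LinearMap.ext fun v => by rw [hlc]; simp [h])
  obtain ⟨i, hi⟩ := hc
  have hfi : Squarefree (f i) := hsq.squarefree_of_dvd (Finset.dvd_prod_of_mem f (Finset.mem_univ i))
  obtain ⟨p, hp, hpi⟩ := WfDvdMonoid.exists_irreducible_factor (hu i) hfi.ne_zero
  replace hp := hp.prime
  obtain ⟨s, hps⟩ := exists_not_dvd_pderiv hp hfi hpi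
  have h1 := hs s
  rw [← Finset.add_sum_erase _ _ (Finset.mem_univ i)] at h1
  -- All terms with `j ≠ i` contain the factor `f i`, hence `p`.
  have h2 : p ∣ (C (c i) * ∏ j ∈ Finset.univ.erase i, f j) * pderiv s (f i) := by
    refine (dvd_add_left (Finset.dvd_sum fun j hj => ?_)).1 (h1 ▸ dvd_zero p)
    refine dvd_mul_of_dvd_left (dvd_mul_of_dvd_right (hpi.trans (Finset.dvd_prod_of_mem f ?_)) _) _
    exact Finset.mem_erase.2 ⟨(Finset.ne_of_mem_erase hj).symm, Finset.mem_univ i⟩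
  rcases hp.dvd_or_dvd ((hp.dvd_or_dvd h2).resolve_right hps) with h3 | h3
  · exact hp.not_isUnit (isUnit_of_dvd_unit h3 ((isUnit_iff_ne_zero.2 hi).map C))
  · obtain ⟨j, hj, hpj⟩ := (hp.dvd_finsetProd_iff _).1 h3
    exact not_dvd_of_squarefree_prod hsq hp hpi (Finset.ne_of_mem_erase hj) hpj

/-- `Der(-log D)` has a basis that consists of lifts of the vector fields `X i ∂/∂X i` along `f`
and of vector fields tangent to the fibres of `f`. -/
theorem exists_adapted_basis (hb : IsBaseChange (CoordRing n) (logDerZero d).subtype)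
    (hsq : Squarefree (∏ i, f i)) (hu : ∀ i, ¬ IsUnit (f i)) (hd : Associated (∏ i, f i) d) :
    ∃ (ι : Type) (b : Module.Basis (Fin k ⊕ ι) (CoordRing n) (logDer d)),
      IsDiagonalLift f (fun i => (b (Sum.inl i)).1) ∧
        ∀ s j, (b (Sum.inr s)).1 (f j) = 0 := by
  classical
  obtain ⟨χ, hχ⟩ := exists_characters hsq hd
  obtain ⟨ι, b, hb₁, hb₂⟩ := exists_basis_sum_of_surjective χ
    (characters_surjective hb hsq hu hd hχ)
  refine ⟨ι, hb.basis b, fun i j => ?_, fun t j => ?_⟩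
  · dsimp only
    rw [IsBaseChange.basis_apply]
    change ((b (Sum.inl i) : logDerZero d) : logDer d).1 (f j) = _
    rw [hχ, hb₁]
    rcases eq_or_ne j i with rfl | hij
    · simp
    · simp [hij]
  · rw [IsBaseChange.basis_apply]
    change ((b (Sum.inr t) : logDerZero d) : logDer d).1 (f j) = _
    rw [hχ, hb₂]
    simp

end LinearFree

/-! ### Freeness of the sum of the divisors -/

theorem free_logDer_mul_bind₁ {n k : ℕ} {d : CoordRing n} {f : Fin k → CoordRing n}
    {h : CoordRing k} {ι : Type*} (b : Module.Basis (Fin k ⊕ ι) (CoordRing n) (logDer d))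
    (hδ : IsDiagonalLift f fun i => (b (Sum.inl i)).1) (hb : ∀ s j, (b (Sum.inr s)).1 (f j) = 0)
    (hsq : Squarefree (d * bind₁ f h))
    [Module.Free (CoordRing n)
      (syzygyModulo (bind₁ f h) fun i => bind₁ f (X i * pderiv i h))] :
    Module.Free (CoordRing n) (logDer (d * bind₁ f h)) := by
  classical
  -- Only the first component, the coordinates on the lifts, affects the `f j`.
  let e : logDer d ≃ₗ[CoordRing n] (Fin k → CoordRing n) × (ι →₀ CoordRing n) :=
    (b.repr.trans (Finsupp.sumFinsuppLEquivProdFinsupp (CoordRing n))).trans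
      ((Finsupp.linearEquivFunOnFinite (CoordRing n) (CoordRing n) (Fin k)).prodCongr
        (LinearEquiv.refl _ _))
  have he : ∀ D : logDer d, ∀ j, D.1 (f j) = (e D).1 j * f j := by
    intro D j
    let ev : logDer d →ₗ[CoordRing n] CoordRing n :=
      { toFun := fun D => D.1 (f j), map_add' := fun _ _ => rfl, map_smul' := fun _ _ => rfl }
    let ev' : logDer d →ₗ[CoordRing n] CoordRing n :=
      LinearMap.mulRight (CoordRing n) (f j) ∘ₗ LinearMap.proj j ∘ₗ LinearMap.fst _ _ _ ∘ₗ
        e.toLinearMap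
    have : ev = ev' := b.ext fun t => by
      rcases t with i | t
      · change (b (Sum.inl i)).1 (f j) = (e (b (Sum.inl i))).1 j * f j
        rw [hδ i j]
        simp [e, Pi.single_apply, eq_comm]
      · change (b (Sum.inr t)).1 (f j) = (e (b (Sum.inr t))).1 j * f j
        rw [hb]
        simp [e]
    exact LinearMap.congr_fun this D
  have hfree := free_comap_fst e
    (syzygyModulo (bind₁ f h) fun i => bind₁ f (X i * pderiv i h))
  have hmap : ((syzygyModulo (bind₁ f h) fun i => bind₁ f (X i * pderiv i h)).comap
      (LinearMap.fst _ _ _ ∘ₗ e.toLinearMap)).map (logDer d).subtype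
        = logDer (d * bind₁ f h) := by
    have key : ∀ D : logDer d, (e D).1 ∈ syzygyModulo (bind₁ f h)
        (fun i => bind₁ f (X i * pderiv i h)) ↔ D.1 ∈ logDer (bind₁ f h) := fun D => by
      rw [mem_syzygyModulo, mem_logDer, derivation_bind₁_of_eq_mul (he D)]
    rw [logDer_mul hsq]
    ext D
    constructor
    · rintro ⟨D, hD, rfl⟩
      exact ⟨D.2, (key D).1 hD⟩
    · rintro ⟨h1, h2⟩
      exact ⟨⟨D, h1⟩, (key ⟨D, h1⟩).2 h2, rfl⟩
  rw [← hmap]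
  exact Module.Free.of_equiv
    (Submodule.equivMapOfInjective (logDer d).subtype (Submodule.subtype_injective _) _)

end

theorem mainTheorem4 {n k : ℕ} (d : CoordRing n) (hd : IsLinearFreeDivisor d)
    (f : Fin k → CoordRing n) (hf : IsComponentPartition d f)
    (h : CoordRing k) (hh : IsFreeDivisor (normalCrossing k * h)) :
    Associated (d * bind₁ f h) (bind₁ f (normalCrossing k * h)) ∧
      IsFreeDivisor (d * bind₁ f h) := by
  have hsq : Squarefree (∏ i, f i) := hf.associated_prod.squarefree_iff.2 hd.squarefree
  obtain ⟨ι, b, hδ, hb⟩ := exists_adapted_basis hd.isBaseChange hsq hf.not_isUnit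
    hf.associated_prod
  have hassoc : Associated ((∏ i, f i) * bind₁ f h) (d * bind₁ f h) :=
    hf.associated_prod.mul_right _
  have hsq' : Squarefree (d * bind₁ f h) :=
    hassoc.squarefree_iff.1 (hδ.squarefree_mul_bind₁ hsq hh.squarefree)
  refine ⟨?_, hsq', ?_⟩
  · rw [map_mul, normalCrossing, map_prod]
    simpa only [bind₁_X_right] using hassoc.symm
  · have := free_syzygyModulo_bind₁ hδ hsq hh
    exact free_logDer_mul_bind₁ b hδ hb hsq'
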